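/- For a finite simple graph $G$ with vertex set $V(G)$ and edge set $E(G)$, let $V$ be the real vector space with basis $(x_i)_{i\in V(G)}$, let $W\subseteq\bigwedge^2V$ be the subspace spanned by the $x_i\wedge x_j$ with $\{i,j\}\notin E(G)$, and let $\mathcal L(G)=V\oplus(\bigwedge^2V)/W$ be the Dani-Mainkar Lie algebra of $G$, i.e. the real 2-step nilpotent Lie algebra with $[x,x']=x\wedge x' \bmod W$ for $x,x'\in V$ and with $(\bigwedge^2V)/W$ central. Let $b_k(G)=\dim_{\mathbb R}H^k(\mathcal L(G))$ be the dimension of its $k$-th Lie algebra cohomology with trivial real coefficients, i.e. of the $k$-th cohomology of the Cartan-Chevalley-Eilenberg complex $\bigwedge^\bullet\mathcal L(G)^*$. **Theorem (Armstrong, Cairns, Jessup).** Let $S_n$ be the star graph with vertices $1,\dots,n+1$ and edges $\{1,2\},\dots,\{1,n+1\}$. Then for all integers $n,k\ge 0$, $$b_k(S_n)=\binom{n+1}{\lceil k/2\rceil}\binom{n}{\lfloor k/2\rfloor}.$$ -/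

import Mathlib

open scoped TensorProduct

noncomputable section

/-! ### Odd derivations of an exterior algebra -/

namespace ExteriorAlgebra

variable {R M : Type*} [CommRing R] [AddCommGroup M] [Module R M]

/-- Elements of exterior degree two commute with elements of exterior degree one. -/
theorem ι_mul_comm_of_mem_two (m : M) {x : ExteriorAlgebra R M} (hx : x ∈ ⋀[R]^2 M) :
    ι R m * x = x * ι R m := by
  rw [exteriorPower, pow_two] at hx
  induction hx using Submodule.mul_induction_on' with
  | mem_mul_mem a ha b hb =>
    obtain ⟨u, rfl⟩ := ha
    obtain ⟨v, rfl⟩ := hb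
    have h1 := eq_neg_of_add_eq_zero_left (ι_add_mul_swap (R := R) m u)
    have h2 := eq_neg_of_add_eq_zero_left (ι_add_mul_swap (R := R) m v)
    rw [← mul_assoc, h1, neg_mul, mul_assoc, h2, mul_neg, neg_neg, mul_assoc]
  | add a _ b _ iha ihb => rw [mul_add, add_mul, iha, ihb]

/-- Auxiliary algebra morphism `a ↦ !![α a, D a; 0, a]`, where `α` is the grade involution
(`α m = -m` on generators) and `D` is the odd derivation which extends `δ`. -/
def oddDerivationAux (δ : M →ₗ[R] ExteriorAlgebra R M) (hδ : ∀ m, δ m ∈ ⋀[R]^2 M) :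
    ExteriorAlgebra R M →ₐ[R] Matrix (Fin 2) (Fin 2) (ExteriorAlgebra R M) :=
  ExteriorAlgebra.lift R ⟨
    { toFun := fun m => !![-ι R m, δ m; 0, ι R m]
      map_add' := fun x y => by
        ext i j; fin_cases i <;> fin_cases j <;> simp [add_comm]
      map_smul' := fun c x => by
        ext i j; fin_cases i <;> fin_cases j <;> simp },
    fun m => by
      have h := ι_mul_comm_of_mem_two m (hδ m)
      ext i j; fin_cases i <;> fin_cases j <;> simp [Matrix.mul_apply, h]⟩

/-- The unique odd derivation `D` of the exterior algebra of `M`, i.e. the unique linear map with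
`D 1 = 0` and `D (m * a) = D m * a - m * D a` for `m` in `M`, whose restriction to `M` is
`δ : M → ⋀² M`. -/
def oddDerivation (δ : M →ₗ[R] ExteriorAlgebra R M) (hδ : ∀ m, δ m ∈ ⋀[R]^2 M) :
    ExteriorAlgebra R M →ₗ[R] ExteriorAlgebra R M where
  toFun a := oddDerivationAux δ hδ a 0 1
  map_add' a b := by simp
  map_smul' c a := by simp

variable (δ : M →ₗ[R] ExteriorAlgebra R M) (hδ : ∀ m, δ m ∈ ⋀[R]^2 M)

theorem oddDerivationAux_ι (m : M) :
    oddDerivationAux δ hδ (ι R m) = !![-ι R m, δ m; 0, ι R m] := by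
  simp only [oddDerivationAux]
  rw [ExteriorAlgebra.lift_ι_apply]
  rfl

theorem oddDerivationAux_apply (a : ExteriorAlgebra R M) :
    oddDerivationAux δ hδ a =
      !![CliffordAlgebra.involute a, oddDerivation δ hδ a; 0, a] := by
  have key : oddDerivationAux δ hδ a 0 0 = CliffordAlgebra.involute a ∧
      oddDerivationAux δ hδ a 1 0 = 0 ∧ oddDerivationAux δ hδ a 1 1 = a := by
    induction a using ExteriorAlgebra.induction with
    | algebraMap r => simp [Matrix.algebraMap_matrix_apply]
    | ι m =>
      rw [oddDerivationAux_ι]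
      exact ⟨(CliffordAlgebra.involute_ι m).symm, rfl, rfl⟩
    | mul a b ha hb =>
      simp [Matrix.mul_apply, ha, hb]
    | add a b ha hb => simp [ha, hb]
  obtain ⟨h1, h2, h3⟩ := key
  ext i j
  fin_cases i <;> fin_cases j
  · simpa using h1
  · rfl
  · simpa using h2
  · simpa using h3

@[simp]
theorem oddDerivation_ι (m : M) : oddDerivation δ hδ (ι R m) = δ m := by
  change oddDerivationAux δ hδ (ι R m) 0 1 = δ m
  rw [oddDerivationAux_ι]
  rfl

@[simp]
theorem oddDerivation_algebraMap (r : R) :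
    oddDerivation δ hδ (algebraMap R (ExteriorAlgebra R M) r) = 0 := by
  change oddDerivationAux δ hδ (algebraMap R (ExteriorAlgebra R M) r) 0 1 = 0
  simp [Matrix.algebraMap_matrix_apply]

/-- The graded Leibniz rule. -/
theorem oddDerivation_mul (a b : ExteriorAlgebra R M) :
    oddDerivation δ hδ (a * b) =
      oddDerivation δ hδ a * b + CliffordAlgebra.involute a * oddDerivation δ hδ b := by
  change oddDerivationAux δ hδ (a * b) 0 1 = _
  rw [map_mul, oddDerivationAux_apply, oddDerivationAux_apply]
  simp [Matrix.mul_apply, add_comm]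

theorem oddDerivation_ι_mul (m : M) (b : ExteriorAlgebra R M) :
    oddDerivation δ hδ (ι R m * b) = δ m * b - ι R m * oddDerivation δ hδ b := by
  rw [oddDerivation_mul, oddDerivation_ι, CliffordAlgebra.involute_ι, neg_mul, sub_eq_add_neg]

/-- An odd derivation raises the degree by one. -/
theorem oddDerivation_mem {k : ℕ} {a : ExteriorAlgebra R M} (ha : a ∈ ⋀[R]^k M) :
    oddDerivation δ hδ a ∈ ⋀[R]^(k + 1) M := by
  induction k generalizing a with
  | zero =>
    rw [exteriorPower, pow_zero, Submodule.mem_one] at ha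
    obtain ⟨r, rfl⟩ := ha
    simp
  | succ k ih =>
    rw [exteriorPower, pow_succ'] at ha
    induction ha using Submodule.mul_induction_on' with
    | mem_mul_mem x hx y hy =>
      obtain ⟨m, rfl⟩ := hx
      rw [oddDerivation_ι_mul]
      refine Submodule.sub_mem _ ?_ ?_
      · have := Submodule.mul_mem_mul (hδ m) hy
        rwa [exteriorPower, ← pow_add, show 2 + k = k + 1 + 1 by ring] at this
      · have := Submodule.mul_mem_mul (LinearMap.mem_range_self (ι R) m) (ih hy)
        rwa [exteriorPower, ← pow_succ'] at this
    | add x _ y _ hx hy =>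
      rw [map_add]
      exact Submodule.add_mem _ hx hy

/-- The square of an odd derivation vanishes as soon as it vanishes on generators. -/
theorem oddDerivation_sq (h : ∀ m, oddDerivation δ hδ (δ m) = 0) (a : ExteriorAlgebra R M) :
    oddDerivation δ hδ (oddDerivation δ hδ a) = 0 := by
  induction a using CliffordAlgebra.left_induction with
  | algebraMap r => 
    have := oddDerivation_algebraMap δ hδ r
    rw [this, map_zero]
  | add x y hx hy => rw [map_add, map_add, hx, hy, add_zero]
  | ι_mul x m hx =>
    have hinv : CliffordAlgebra.involute (δ m) = δ m := by
      have h2 := hδ m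
      rw [exteriorPower, pow_two] at h2
      refine Submodule.mul_induction_on h2 ?_ ?_
      · rintro _ ⟨u, rfl⟩ _ ⟨v, rfl⟩
        rw [map_mul, CliffordAlgebra.involute_ι, CliffordAlgebra.involute_ι, neg_mul_neg]
      · intro x y hx hy
        rw [map_add, hx, hy]
    have e := oddDerivation_ι_mul δ hδ m x
    rw [e, map_sub, oddDerivation_mul, h, oddDerivation_ι_mul, hx, hinv]
    simp

end ExteriorAlgebra

/-! ### The Cartan-Chevalley-Eilenberg complex of a finite-dimensional real Lie algebra -/

namespace CartanChevalleyEilenberg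

open ExteriorAlgebra Module

variable {L : Type*} [LieRing L] [LieAlgebra ℝ L]

/-- The alternating form `(x, y) ↦ f ⁅x, y⁆` on `L`, as a linear map `L → L*`. -/
def bracketForm (f : Dual ℝ L) : L →ₗ[ℝ] Dual ℝ L :=
  (LieAlgebra.ad ℝ L : L →ₗ[ℝ] L →ₗ[ℝ] L).compr₂ f

@[simp]
theorem bracketForm_apply (f : Dual ℝ L) (x y : L) : bracketForm f x y = f ⁅x, y⁆ := rfl

theorem ι_mul_ι_mem (φ ψ : Dual ℝ L) : ι ℝ φ * ι ℝ ψ ∈ ⋀[ℝ]^2 (Dual ℝ L) := by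
  rw [exteriorPower, pow_two]
  exact Submodule.mul_mem_mul (LinearMap.mem_range_self _ _) (LinearMap.mem_range_self _ _)

variable (L) in
/-- The product `φ ⊗ ψ ↦ φ * ψ` into the exterior algebra of the dual of `L`. -/
def wedge : Dual ℝ L ⊗[ℝ] Dual ℝ L →ₗ[ℝ] ExteriorAlgebra ℝ (Dual ℝ L) :=
  TensorProduct.lift ((LinearMap.mul ℝ (ExteriorAlgebra ℝ (Dual ℝ L))).compl₁₂ (ι ℝ) (ι ℝ))

@[simp]
theorem wedge_tmul (φ ψ : Dual ℝ L) : wedge L (φ ⊗ₜ ψ) = ι ℝ φ * ι ℝ ψ := rfl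

theorem wedge_mem (t : Dual ℝ L ⊗[ℝ] Dual ℝ L) : wedge L t ∈ ⋀[ℝ]^2 (Dual ℝ L) := by
  induction t using TensorProduct.induction_on with
  | zero => simp
  | tmul φ ψ => exact ι_mul_ι_mem φ ψ
  | add x y hx hy => rw [map_add]; exact Submodule.add_mem _ hx hy

variable [Module.Finite ℝ L]

variable (L) in
/-- The differential on linear forms: `f` goes to the alternating form `(x, y) ↦ f ⁅x, y⁆`, seen as
an element of `⋀² L*`, where `φ * ψ` stands for the form `(x, y) ↦ φ x * ψ y - ψ x * φ y`. -/
def differentialOne : Dual ℝ L →ₗ[ℝ] ExteriorAlgebra ℝ (Dual ℝ L) where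
  toFun f := (1 / 2 : ℝ) • wedge L ((dualTensorHomEquiv ℝ L (Dual ℝ L)).symm (bracketForm f))
  map_add' f g := by
    rw [show bracketForm (f + g) = bracketForm f + bracketForm g by ext; simp,
      map_add, map_add, smul_add]
  map_smul' c f := by
    rw [show bracketForm (c • f) = c • bracketForm f by ext; simp,
      map_smul, map_smul, smul_comm, RingHom.id_apply]

theorem differentialOne_mem (f : Dual ℝ L) : differentialOne L f ∈ ⋀[ℝ]^2 (Dual ℝ L) :=
  Submodule.smul_mem _ _ (wedge_mem _)

/-- If `f ⁅x, y⁆ = φ x * ψ y - ψ x * φ y`, then the differential of `f` is `φ * ψ`. -/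
theorem differentialOne_eq_mul {f φ ψ : Dual ℝ L}
    (h : ∀ x y, f ⁅x, y⁆ = φ x * ψ y - ψ x * φ y) :
    differentialOne L f = ι ℝ φ * ι ℝ ψ := by
  have e : bracketForm f = dualTensorHomEquiv ℝ L (Dual ℝ L) (φ ⊗ₜ ψ - ψ ⊗ₜ φ) := by
    ext x y
    simp [dualTensorHomEquiv, h]
  change (1 / 2 : ℝ) • wedge L ((dualTensorHomEquiv ℝ L (Dual ℝ L)).symm (bracketForm f)) = _
  rw [e, LinearEquiv.symm_apply_apply, map_sub, wedge_tmul, wedge_tmul,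
    eq_neg_of_add_eq_zero_left (ι_add_mul_swap (R := ℝ) ψ φ), sub_neg_eq_add, ← two_smul ℝ,
    smul_smul]
  norm_num

/-- The differential on linear forms in terms of a basis. -/
theorem differentialOne_eq_sum {J : Type*} [Fintype J] (b : Basis J ℝ L) (f : Dual ℝ L) :
    differentialOne L f = (1 / 2 : ℝ) • ∑ i, ι ℝ (b.coord i) * ι ℝ (bracketForm f (b i)) := by
  classical
  have e : bracketForm f =
      dualTensorHomEquiv ℝ L (Dual ℝ L) (∑ i, b.coord i ⊗ₜ bracketForm f (b i)) := by
    refine b.ext fun j => ?_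
    simp [dualTensorHomEquiv, Finsupp.single_apply]
  change (1 / 2 : ℝ) • wedge L ((dualTensorHomEquiv ℝ L (Dual ℝ L)).symm (bracketForm f)) = _
  conv_lhs => rw [e, LinearEquiv.symm_apply_apply, map_sum]
  rfl

variable (L) in
/-- The differential `Q` of the Cartan-Chevalley-Eilenberg complex of `L` with trivial real
coefficients: the odd derivation of the exterior algebra of `L*` which is dual to the bracket
on linear forms. -/
def differential : ExteriorAlgebra ℝ (Dual ℝ L) →ₗ[ℝ] ExteriorAlgebra ℝ (Dual ℝ L) :=
  oddDerivation (differentialOne L) differentialOne_mem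

theorem differential_mem {k : ℕ} {a : ExteriorAlgebra ℝ (Dual ℝ L)}
    (ha : a ∈ ⋀[ℝ]^k (Dual ℝ L)) : differential L a ∈ ⋀[ℝ]^(k + 1) (Dual ℝ L) :=
  oddDerivation_mem _ _ ha

/-- By the Jacobi identity the differential squares to zero on linear forms. -/
theorem differential_differentialOne (f : Dual ℝ L) : differential L (differentialOne L f) = 0 := by
  classical
  let b := Module.finBasis ℝ L
  let h := fun i => ι ℝ (b.coord i)
  have hι : ∀ g : Dual ℝ L, ι ℝ g = ∑ i, g (b i) • h i := fun g => by
    have hg : g = ∑ i, g (b i) • b.coord i := by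
      refine b.ext fun j => ?_
      simp
    refine (congrArg (ι ℝ) hg).trans ?_
    rw [map_sum]
    simp only [map_smul, h]
  have hbr : ∀ (g : Dual ℝ L) (x y : L), bracketForm g x y = g ⁅x, y⁆ := fun _ _ _ => rfl
  -- the four sums which occur
  let X := ∑ i, ∑ j, ∑ k, f ⁅⁅b i, b j⁆, b k⁆ • (h i * h j * h k)
  let S := ∑ i, ∑ j, ∑ k, f ⁅b i, ⁅b j, b k⁆⁆ • (h i * h j * h k)
  let T := ∑ i, ∑ j, ∑ k, f ⁅b j, ⁅b i, b k⁆⁆ • (h i * h j * h k)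
  have hanti : ∀ i j, h i * h j = -(h j * h i) := fun i j =>
    eq_neg_of_add_eq_zero_left (ι_add_mul_swap (R := ℝ) _ _)
  have hcyc : ∀ i j k, h i * h j * h k = h j * h k * h i := fun i j k => by
    rw [mul_assoc, hanti j k, mul_neg, ← mul_assoc, hanti i k, neg_mul, neg_neg, mul_assoc,
      hanti i j, mul_neg, ← mul_assoc, hanti k j, neg_mul, neg_neg, neg_mul, neg_mul, neg_neg]
  have hT : T = -S := by
    simp only [T, S]
    rw [Finset.sum_comm, ← Finset.sum_neg_distrib]
    refine Finset.sum_congr rfl fun i _ => ?_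
    rw [← Finset.sum_neg_distrib]
    refine Finset.sum_congr rfl fun j _ => ?_
    rw [← Finset.sum_neg_distrib]
    refine Finset.sum_congr rfl fun k _ => ?_
    rw [hanti j i, neg_mul, smul_neg]
  have hJ : X = S - T := by
    simp only [X, S, T, ← Finset.sum_sub_distrib, ← sub_smul, ← map_sub]
    refine Finset.sum_congr rfl fun i _ => Finset.sum_congr rfl fun j _ =>
      Finset.sum_congr rfl fun k _ => ?_
    rw [lie_lie]
  have hS : S = -X := by
    have e : X = ∑ i, ∑ j, ∑ k, f ⁅⁅b j, b k⁆, b i⁆ • (h j * h k * h i) := by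
      simp only [X]
      rw [Finset.sum_comm' (t' := Finset.univ) (s' := fun _ => Finset.univ) (by simp)]
      conv_rhs => rw [Finset.sum_comm]
      refine Eq.trans ?_ (Finset.sum_congr rfl fun j _ => Finset.sum_comm)
      rw [Finset.sum_comm]
    rw [e, ← Finset.sum_neg_distrib]
    simp only [S]
    refine Finset.sum_congr rfl fun i _ => ?_
    rw [← Finset.sum_neg_distrib]
    refine Finset.sum_congr rfl fun j _ => ?_
    rw [← Finset.sum_neg_distrib]
    refine Finset.sum_congr rfl fun k _ => ?_
    rw [hcyc, ← lie_skew, map_neg, neg_smul]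
  have hX : X = 0 := by
    have h3 : (3 : ℝ) • X = 0 := by
      rw [hT, hS] at hJ
      have : X + X + X = 0 := by
        nth_rewrite 1 [hJ]
        abel
      rw [show (3 : ℝ) = 1 + 1 + 1 by norm_num, add_smul, add_smul, one_smul]
      exact this
    exact (smul_eq_zero.mp h3).resolve_left (by norm_num)
  have hS0 : S = 0 := by rw [hS, hX, neg_zero]
  -- the first half of the Leibniz rule
  have hA : ∑ i, differentialOne L (b.coord i) * ι ℝ (bracketForm f (b i)) =
      (1 / 2 : ℝ) • X := by
    have e1 : ∀ i, differentialOne L (b.coord i) =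
        (1 / 2 : ℝ) • ∑ j, ∑ k, b.coord i ⁅b j, b k⁆ • (h j * h k) := fun i => by
      rw [differentialOne_eq_sum b]
      congr 1
      refine Finset.sum_congr rfl fun j _ => ?_
      rw [hι (bracketForm _ _), Finset.mul_sum]
      refine Finset.sum_congr rfl fun k _ => ?_
      rw [mul_smul_comm, hbr]
    have e2 : ∀ j k, ∑ i, b.coord i ⁅b j, b k⁆ • ι ℝ (bracketForm f (b i)) =
        ∑ l, f ⁅⁅b j, b k⁆, b l⁆ • h l := fun j k => by
      have e3 : bracketForm f ⁅b j, b k⁆ =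
          ∑ i, b.coord i ⁅b j, b k⁆ • bracketForm f (b i) := by
        refine (congrArg (bracketForm f) (b.sum_repr ⁅b j, b k⁆).symm).trans ?_
        rw [map_sum]
        simp only [map_smul, Basis.coord_apply]
      have e4 := hι (bracketForm f ⁅b j, b k⁆)
      rw [e3, map_sum] at e4
      simp only [map_smul] at e4
      rw [e4]
      refine Finset.sum_congr rfl fun l _ => ?_
      rw [← e3, hbr]
    simp only [e1, smul_mul_assoc, ← Finset.smul_sum]
    congr 1
    simp only [Finset.sum_mul, X]
    rw [Finset.sum_comm]
    refine Finset.sum_congr rfl fun j _ => ?_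
    rw [Finset.sum_comm]
    refine Finset.sum_congr rfl fun k _ => ?_
    simp only [← mul_smul_comm (_ : ℝ) (h j * h k)]
    rw [← Finset.mul_sum, ← e2, Finset.mul_sum]
    simp only [smul_mul_assoc, mul_smul_comm]
  -- the second half of the Leibniz rule
  have hB : ∑ i, h i * differentialOne L (bracketForm f (b i)) = (1 / 2 : ℝ) • S := by
    have e1 : ∀ i, differentialOne L (bracketForm f (b i)) =
        (1 / 2 : ℝ) • ∑ j, ∑ k, f ⁅b i, ⁅b j, b k⁆⁆ • (h j * h k) := fun i => by
      rw [differentialOne_eq_sum b]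
      congr 1
      refine Finset.sum_congr rfl fun j _ => ?_
      rw [hι (bracketForm _ _), Finset.mul_sum]
      refine Finset.sum_congr rfl fun k _ => ?_
      rw [mul_smul_comm, hbr, hbr]
    simp only [e1, mul_smul_comm, ← Finset.smul_sum, Finset.mul_sum, S, mul_assoc]
  rw [differentialOne_eq_sum b, map_smul, map_sum]
  simp only [differential, oddDerivation_ι_mul, oddDerivation_ι, Finset.sum_sub_distrib]
  rw [hA, hB, hX, hS0]
  simp

theorem differential_differential (a : ExteriorAlgebra ℝ (Dual ℝ L)) :
    differential L (differential L a) = 0 :=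
  oddDerivation_sq _ _ differential_differentialOne a

variable (L) in
/-- The `k`-cocycles. -/
def cocycles (k : ℕ) : Submodule ℝ (ExteriorAlgebra ℝ (Dual ℝ L)) :=
  ⋀[ℝ]^k (Dual ℝ L) ⊓ LinearMap.ker (differential L)

variable (L) in
/-- The `k`-coboundaries. -/
def coboundaries : ℕ → Submodule ℝ (ExteriorAlgebra ℝ (Dual ℝ L))
  | 0 => ⊥
  | k + 1 => (⋀[ℝ]^k (Dual ℝ L)).map (differential L)

theorem coboundaries_le_cocycles (k : ℕ) : coboundaries L k ≤ cocycles L k := by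
  cases k with
  | zero => exact bot_le
  | succ k =>
    rintro _ ⟨a, ha, rfl⟩
    exact ⟨differential_mem ha, differential_differential a⟩

variable (L) in
/-- The cohomology `H^k(L)` with trivial real coefficients: cocycles modulo coboundaries. -/
abbrev Cohomology (k : ℕ) : Type _ :=
  cocycles L k ⧸ (coboundaries L k).submoduleOf (cocycles L k)

instance (k : ℕ) : Module.Finite ℝ (cocycles L k) :=
  Submodule.finiteDimensional_of_le (inf_le_left : cocycles L k ≤ ⋀[ℝ]^k (Dual ℝ L))

theorem finite_cohomology (k : ℕ) : Module.Finite ℝ (Cohomology L k) := inferInstance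

end CartanChevalleyEilenberg

/-! ### Dani-Mainkar Lie algebras -/

section DaniMainkar

variable {V : Type*} [DecidableEq V]

/-- The subspace of the exterior square of the space with basis `x_i`, for `i` in `V`, generated by
the monomials `x_i ∧ x_j` for which `{i, j}` is not an edge of `G`. -/
def SimpleGraph.nonEdgeSpan (G : SimpleGraph V) : Submodule ℝ (⋀[ℝ]^2 (V → ℝ)) :=
  Submodule.span ℝ {w | ∃ i j : V, ¬ G.Adj i j ∧
    w = exteriorPower.ιMulti ℝ 2 ![Pi.single i (1 : ℝ), Pi.single j (1 : ℝ)]}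

/-- The vector space underlying the Dani-Mainkar Lie algebra of `G`: the direct sum of the real
vector space with basis indexed by the vertices and of its exterior square modulo non-edges. -/
def DaniMainkar (G : SimpleGraph V) : Type _ :=
  (V → ℝ) × (⋀[ℝ]^2 (V → ℝ) ⧸ G.nonEdgeSpan)

namespace DaniMainkar

variable (G : SimpleGraph V)

instance : AddCommGroup (DaniMainkar G) :=
  inferInstanceAs (AddCommGroup ((V → ℝ) × (⋀[ℝ]^2 (V → ℝ) ⧸ G.nonEdgeSpan)))

instance : Module ℝ (DaniMainkar G) :=
  inferInstanceAs (Module ℝ ((V → ℝ) × (⋀[ℝ]^2 (V → ℝ) ⧸ G.nonEdgeSpan)))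

instance [Fintype V] : Module.Finite ℝ (DaniMainkar G) :=
  inferInstanceAs (Module.Finite ℝ ((V → ℝ) × (⋀[ℝ]^2 (V → ℝ) ⧸ G.nonEdgeSpan)))

/-- The class of `x ∧ y` in the quotient of the exterior square, bilinearly in `x` and `y`. -/
def wedgeClass : (V → ℝ) →ₗ[ℝ] (V → ℝ) →ₗ[ℝ] (⋀[ℝ]^2 (V → ℝ) ⧸ G.nonEdgeSpan) :=
  LinearMap.mk₂ ℝ (fun x y => G.nonEdgeSpan.mkQ (exteriorPower.ιMulti ℝ 2 ![x, y]))
    (fun x x' y => by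
      rw [← map_add]
      congr 1
      ext
      simp [ExteriorAlgebra.ιMulti_apply, add_mul])
    (fun c x y => by
      rw [← map_smul]
      congr 1
      ext
      simp [ExteriorAlgebra.ιMulti_apply])
    (fun x y y' => by
      rw [← map_add]
      congr 1
      ext
      simp [ExteriorAlgebra.ιMulti_apply, mul_add])
    (fun c x y => by
      rw [← map_smul]
      congr 1
      ext
      simp [ExteriorAlgebra.ιMulti_apply])

theorem wedgeClass_apply (x y : V → ℝ) :
    wedgeClass G x y = G.nonEdgeSpan.mkQ (exteriorPower.ιMulti ℝ 2 ![x, y]) := rfl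

theorem wedgeClass_self (x : V → ℝ) : wedgeClass G x x = 0 := by
  rw [wedgeClass_apply, (exteriorPower.ιMulti ℝ 2).map_eq_zero_of_eq ![x, x]
    (i := 0) (j := 1) rfl (by decide), map_zero]

/-- The bracket: `[x, y] = x ∧ y` modulo non-edges for `x`, `y` in the span of the vertices, and the
quotient of the exterior square is central. -/
instance : Bracket (DaniMainkar G) (DaniMainkar G) :=
  ⟨fun u v => (0, wedgeClass G u.1 v.1)⟩

theorem bracket_def (u v : DaniMainkar G) : ⁅u, v⁆ = (0, wedgeClass G u.1 v.1) := rfl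

instance : LieRing (DaniMainkar G) where
  add_lie u v w := by
    refine Prod.ext (add_zero _).symm ?_
    change wedgeClass G (u.1 + v.1) w.1 = wedgeClass G u.1 w.1 + wedgeClass G v.1 w.1
    rw [map_add, LinearMap.add_apply]
  lie_add u v w := by
    refine Prod.ext (add_zero _).symm ?_
    change wedgeClass G u.1 (v.1 + w.1) = wedgeClass G u.1 v.1 + wedgeClass G u.1 w.1
    rw [map_add]
  lie_self u := Prod.ext rfl (wedgeClass_self G u.1)
  leibniz_lie u v w := by
    refine Prod.ext (add_zero _).symm ?_
    change wedgeClass G u.1 0 = wedgeClass G 0 w.1 + wedgeClass G v.1 0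
    simp

instance : LieAlgebra ℝ (DaniMainkar G) where
  lie_smul c u v := by
    refine Prod.ext (smul_zero c).symm ?_
    change wedgeClass G u.1 (c • v.1) = c • wedgeClass G u.1 v.1
    rw [map_smul]

end DaniMainkar

/-- The Betti number `b_k(G)`: the dimension of the `k`-th cohomology of the Dani-Mainkar Lie
algebra of `G`. -/
def SimpleGraph.bettiNumber [Fintype V] (G : SimpleGraph V) (k : ℕ) : ℕ :=
  Module.finrank ℝ (CartanChevalleyEilenberg.Cohomology (DaniMainkar G) k)

end DaniMainkar

end

/-! Let `c`, `x_i`, `z_i` be the basis of the dual space that is dual to the center, the leaves and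
the edges. The differential kills `c` and the `x_i` and sends `z_i` to `c ∧ x_i`. Hence it is `a ↦ c
∧ E a`, where `E` is the even derivation with `z_i ↦ x_i`, `x_i ↦ 0`, `c ↦ 0`
(`oddDerivation_eq_ι_mul_evenDerivation`). Every multiple of `c` is a cocycle, and a form free of
`c` is a cocycle exactly when `E` kills it.

On forms in the `x_i`, `z_i`, the operator `E` is the raising operator of an `sl₂`-triple for which
`x_i` has weight `1` and `z_i` weight `-1`. An irreducible representation of `sl₂` meets the kernel
of `E` in one line and has exactly one weight line of weight `0` or `1`, so the kernel has as many
dimensions as there are basis vectors of these weights (`finrank_ker_raising`). A product of `p` of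
the `x_i` and `q` of the `z_i` has weight `p - q`, so in degree `k` only `p = ⌈k/2⌉`, `q = ⌊k/2⌋`
counts. Together with the multiples of `c` this gives `dim Z^k = C(2n, k-1) + C(n, ⌈k/2⌉) C(n,
⌊k/2⌋)`. Both parts are counted at once by composing the triple with the projection `coreProj` that
kills the monomials containing `c`: these acquire weight `0` and lie in the kernel.

By rank-nullity `b_k = dim Z^k + dim Z^(k-1) - C(2n+1, k-1)`. Pascal's rule cancels the binomials of
`2n` and `2n+1`, and applied once more it merges the two remaining products. -/

/-! ### Kernels of raising operators -/

section Sl2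

open Module

variable {M : Type*} [AddCommGroup M] [Module ℝ M]

/-- In a finite-dimensional representation of `sl₂`, a primitive vector has nonnegative weight. -/
theorem nonneg_weight_of_primitive [Module.Finite ℝ M] {E F H : End ℝ M} (hEF : ⁅E, F⁆ = H)
    (hHE : ⁅H, E⁆ = 2 • E) (hHF : ⁅H, F⁆ = -(2 • F)) {v : M} (hv : v ≠ 0) (hE : E v = 0)
    {μ : ℤ} (hμ : H v = (μ : ℝ) • v) : 0 ≤ μ := by
  -- `IsSl2Triple` demands `H ≠ 0`, which follows from `μ ≠ 0` but may fail for `μ = 0`.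
  rcases eq_or_ne μ 0 with rfl | h0
  · exact le_rfl
  have hH : H ≠ 0 := by
    rintro rfl
    rw [LinearMap.zero_apply, eq_comm, smul_eq_zero] at hμ
    exact hμ.elim (fun h => h0 (by exact_mod_cast h)) hv
  let : LieRing (End ℝ M) := LieRing.ofAssociativeRing
  have t : IsSl2Triple H E F := ⟨hH, hEF, hHE, hHF⟩
  have P : t.HasPrimitiveVectorWith v (μ : ℝ) := ⟨hv, hμ, hE⟩
  obtain ⟨n, hn⟩ := P.exists_nat
  have : μ = n := by exact_mod_cast hn
  omega

variable {I : Type*} (b : Basis I ℝ M) (w : I → ℤ)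

/-- The projection to the span of the basis vectors of weight `l`. -/
noncomputable def weightProj (l : ℤ) : End ℝ M :=
  b.constr ℝ fun i => if w i = l then b i else 0

theorem weightProj_basis (l : ℤ) (i : I) :
    weightProj b w l (b i) = if w i = l then b i else 0 := by
  rw [weightProj, Basis.constr_basis]

theorem repr_weightProj (l : ℤ) (v : M) (i : I) :
    b.repr (weightProj b w l v) i = if w i = l then b.repr v i else 0 := by
  have h : b.coord i ∘ₗ weightProj b w l = if w i = l then b.coord i else 0 := by
    refine b.ext fun j => ?_
    rw [LinearMap.comp_apply, weightProj_basis]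
    by_cases hij : j = i
    · subst hij
      split_ifs <;> simp
    · split_ifs <;> simp [hij]
  have := LinearMap.congr_fun h v
  rw [LinearMap.comp_apply, Basis.coord_apply] at this
  rw [this]
  split_ifs <;> simp

variable {w} {H : End ℝ M} (hb : ∀ i, H (b i) = (w i : ℝ) • b i)
include hb

theorem weight_comp_weightProj (l : ℤ) : H * weightProj b w l = (l : ℝ) • weightProj b w l := by
  refine b.ext fun i => ?_
  rw [Module.End.mul_apply, LinearMap.smul_apply, weightProj_basis]
  split_ifs with h
  · rw [hb, h]
  · simp

theorem weightProj_comp_weight (l : ℤ) : weightProj b w l * H = (l : ℝ) • weightProj b w l := by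
  refine b.ext fun i => ?_
  rw [Module.End.mul_apply, LinearMap.smul_apply, hb, map_smul, weightProj_basis]
  split_ifs with h
  · rw [h]
  · simp

theorem repr_weight (v : M) (i : I) : b.repr (H v) i = (w i : ℝ) * b.repr v i := by
  have h : b.coord i ∘ₗ H = (w i : ℝ) • b.coord i := by
    refine b.ext fun j => ?_
    by_cases hij : j = i
    · subst hij; simp [hb]
    · simp [hb, hij]
  simpa using LinearMap.congr_fun h v

/-- Comparing coordinates in `H v = m v`, each `i` has `w i = m` or coordinate zero. -/
theorem weightProj_of_weight {v : M} {m : ℤ} (hv : H v = (m : ℝ) • v) (l : ℤ) :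
    weightProj b w l v = if m = l then v else 0 := by
  refine b.ext_elem fun i => ?_
  have h := repr_weight b hb v i
  rw [hv, map_smul, Finsupp.smul_apply, smul_eq_mul] at h
  have h' : w i = m ∨ b.repr v i = 0 := by
    rcases mul_eq_mul_right_iff.mp h with h | h
    · exact Or.inl (by exact_mod_cast h.symm)
    · exact Or.inr h
  rw [repr_weightProj]
  rcases h' with h' | h'
  · rw [h']; split_ifs <;> simp
  · split_ifs <;> simp [h']

/-- The relation `[H, E] = 2E` makes `E` raise weights by two. -/
theorem raising_comp_weightProj {E : End ℝ M} (hHE : ⁅H, E⁆ = 2 • E) (l : ℤ) :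
    E * weightProj b w l = weightProj b w (l + 2) * E := by
  refine b.ext fun i => ?_
  have h : H (E (b i)) = ((w i + 2 : ℤ) : ℝ) • E (b i) := by
    have := LinearMap.congr_fun hHE (b i)
    rw [Ring.lie_def, LinearMap.sub_apply, Module.End.mul_apply, Module.End.mul_apply, hb,
      map_smul, sub_eq_iff_eq_add] at this
    rw [this, LinearMap.smul_apply]
    push_cast
    rw [add_smul, add_comm, two_smul, two_smul]
  rw [Module.End.mul_apply, Module.End.mul_apply, weightProj_basis, weightProj_of_weight b hb h]
  by_cases hl : w i = l
  · simp [hl]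
  · simp [hl]

/-- The dimension of the kernel of the raising operator of a representation of `sl₂` with a basis
of weight vectors is the number of basis vectors of weight zero or one. -/
theorem finrank_ker_raising [Module.Finite ℝ M] [Fintype I] {E F : End ℝ M} (hEF : ⁅E, F⁆ = H)
    (hHE : ⁅H, E⁆ = 2 • E) (hHF : ⁅H, F⁆ = -(2 • F)) :
    finrank ℝ (LinearMap.ker E) = Nat.card {i // w i = 0 ∨ w i = 1} := by
  -- No decomposition into irreducibles is needed: the kernel of `E` lies in `P`, and `E` maps `P`
  -- onto `Q`, so the kernel has dimension `dim P - dim Q`.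
  let P : Submodule ℝ M := Submodule.span ℝ (b '' {i | 0 ≤ w i})
  let Q : Submodule ℝ M := Submodule.span ℝ (b '' {i | 2 ≤ w i})
  have hker : LinearMap.ker E ≤ P := by
    intro v hv
    rw [Basis.mem_span_image]
    intro i hi
    have hi' : b.repr v i ≠ 0 := by simpa using hi
    -- A nonzero weight component of a vector in the kernel is again in the kernel, hence primitive.
    refine nonneg_weight_of_primitive hEF hHE hHF (v := weightProj b w (w i) v) ?_ ?_ ?_
    · intro h
      have := repr_weightProj b w (w i) v i
      rw [h, if_pos rfl] at this
      exact hi' (by simpa using this.symm)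
    · have := LinearMap.congr_fun (raising_comp_weightProj b hb hHE (w i)) v
      rw [Module.End.mul_apply, Module.End.mul_apply, LinearMap.mem_ker.mp hv, map_zero] at this
      exact this
    · exact LinearMap.congr_fun (weight_comp_weightProj b hb (w i)) v
  have hproj : ∀ l v, 0 ≤ l → weightProj b w l v ∈ P := by
    intro l v hl
    rw [Basis.mem_span_image]
    intro i hi
    have hi' : b.repr (weightProj b w l v) i ≠ 0 := by simpa using hi
    rw [repr_weightProj] at hi'
    have : w i = l := by by_contra h; exact hi' (if_neg h)
    change 0 ≤ w i
    omega
  have hmap : P.map E = Q := by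
    apply le_antisymm
    · rw [Submodule.map_span, Submodule.span_le]
      rintro _ ⟨_, ⟨i, hi, rfl⟩, rfl⟩
      have h := LinearMap.congr_fun (raising_comp_weightProj b hb hHE (w i)) (b i)
      rw [Module.End.mul_apply, Module.End.mul_apply, weightProj_basis, if_pos rfl] at h
      rw [h, SetLike.mem_coe, Basis.mem_span_image]
      intro j hj
      have hj' : b.repr (weightProj b w (w i + 2) (E (b i))) j ≠ 0 := by simpa using hj
      rw [repr_weightProj] at hj'
      have : w j = w i + 2 := by by_contra h; exact hj' (if_neg h)
      have hi' : 0 ≤ w i := hi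
      change 2 ≤ w j
      omega
    · rw [Submodule.span_le]
      rintro _ ⟨i, hi, rfl⟩
      have hi' : 2 ≤ w i := hi
      -- Surjectivity is the first inclusion for the dual representation: a functional that vanishes
      -- on `E P` but not on `b i` yields a primitive vector of weight `-w i < 0`. Transposition
      -- reverses brackets, hence the sign in `-H.dualMap`.
      by_contra hmem
      obtain ⟨φ, hφ, hle⟩ := Submodule.exists_le_ker_of_notMem hmem
      have key : 0 ≤ -w i := by
        refine nonneg_weight_of_primitive (M := Dual ℝ M) (E := E.dualMap) (F := F.dualMap)
          (H := -H.dualMap) ?_ ?_ ?_ (v := φ ∘ₗ weightProj b w (w i)) ?_ ?_ ?_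
        · rw [← hEF]
          ext ψ v
          simp [Ring.lie_def]
        · ext ψ v
          have := congrArg ψ (LinearMap.congr_fun hHE v)
          simp only [Ring.lie_def, LinearMap.sub_apply, Module.End.mul_apply, map_sub,
            LinearMap.smul_apply, map_nsmul] at this
          simp only [Ring.lie_def, LinearMap.sub_apply, Module.End.mul_apply, LinearMap.neg_apply,
            LinearMap.dualMap_apply, LinearMap.smul_apply, map_neg, ← this]
          ring
        · ext ψ v
          have := congrArg ψ (LinearMap.congr_fun hHF v)
          simp only [Ring.lie_def, LinearMap.sub_apply, Module.End.mul_apply, map_sub,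
            LinearMap.smul_apply, map_nsmul, LinearMap.neg_apply, map_neg] at this
          simp only [Ring.lie_def, LinearMap.sub_apply, Module.End.mul_apply, LinearMap.neg_apply,
            LinearMap.dualMap_apply, LinearMap.smul_apply, map_neg, ← this]
          ring
        · intro h
          have := LinearMap.congr_fun h (b i)
          rw [LinearMap.comp_apply, weightProj_basis, if_pos rfl] at this
          exact hφ this
        · ext v
          have := LinearMap.congr_fun (raising_comp_weightProj b hb hHE (w i - 2)) v
          rw [Module.End.mul_apply, Module.End.mul_apply, sub_add_cancel] at this
          rw [LinearMap.dualMap_apply, LinearMap.comp_apply, ← this]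
          -- The component of weight `w i - 2` lies in `P` because `2 ≤ w i`, so `φ` vanishes on its
          -- image under `E`.
          exact hle ⟨_, hproj _ _ (by omega), rfl⟩
        · ext v
          have := LinearMap.congr_fun (weightProj_comp_weight b hb (w i)) v
          rw [Module.End.mul_apply] at this
          rw [LinearMap.neg_apply, LinearMap.neg_apply, LinearMap.dualMap_apply,
            LinearMap.comp_apply, this]
          simp
      omega
  have hcard : ∀ p : Set I, finrank ℝ (Submodule.span ℝ (b '' p)) = Nat.card p := by
    intro p
    classical
    rw [Set.image_eq_range]
    exact (finrank_span_eq_card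
      (b.linearIndependent.comp (Subtype.val : p → I) Subtype.val_injective)).trans
      Fintype.card_eq_nat_card
  have hsum := LinearMap.finrank_range_add_finrank_ker (E.domRestrict P)
  have hr : LinearMap.range (E.domRestrict P) = Q := by
    rw [LinearMap.range_domRestrict, hmap]
  have hk : finrank ℝ (LinearMap.ker (E.domRestrict P)) = finrank ℝ (LinearMap.ker E) := by
    rw [LinearMap.ker_domRestrict]
    exact (Submodule.submoduleOfEquivOfLe hker).finrank_eq
  have hPQ : Nat.card {i | 0 ≤ w i} =
      Nat.card {i | 2 ≤ w i} + Nat.card {i // w i = 0 ∨ w i = 1} := by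
    change Nat.card {i | 0 ≤ w i} = Nat.card {i | 2 ≤ w i} + Nat.card {i | w i = 0 ∨ w i = 1}
    simp only [Nat.card_coe_set_eq]
    rw [← Set.ncard_union_eq]
    · congr 1
      ext i
      simp only [Set.mem_ofPred_eq, Set.mem_union]
      omega
    · rw [Set.disjoint_left]
      intro i hi hi'
      simp only [Set.mem_ofPred_eq] at hi hi'
      omega
  rw [hr, hk, hcard, hcard, hPQ] at hsum
  omega

end Sl2

/-! ### Even derivations of an exterior algebra -/

namespace ExteriorAlgebra

variable {R M : Type*} [CommRing R] [AddCommGroup M] [Module R M]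

/-- Auxiliary algebra morphism `a ↦ !![a, D a; 0, a]`, where `D` is the derivation which
extends `A`. -/
noncomputable def evenDerivationAux (A : Module.End R M) :
    ExteriorAlgebra R M →ₐ[R] Matrix (Fin 2) (Fin 2) (ExteriorAlgebra R M) :=
  ExteriorAlgebra.lift R ⟨
    { toFun := fun m => !![ι R m, ι R (A m); 0, ι R m]
      map_add' := fun x y => by
        ext i j; fin_cases i <;> fin_cases j <;> simp
      map_smul' := fun c x => by
        ext i j; fin_cases i <;> fin_cases j <;> simp },
    fun m => by
      have h := ι_add_mul_swap (R := R) m (A m)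
      ext i j; fin_cases i <;> fin_cases j <;> simp [Matrix.mul_apply, h]⟩

/-- The derivation of the exterior algebra of `M` which extends an endomorphism of `M`. -/
noncomputable def evenDerivation (A : Module.End R M) : Module.End R (ExteriorAlgebra R M) where
  toFun a := evenDerivationAux A a 0 1
  map_add' a b := by simp
  map_smul' c a := by simp

theorem evenDerivationAux_ι (A : Module.End R M) (m : M) :
    evenDerivationAux A (ι R m) = !![ι R m, ι R (A m); 0, ι R m] := by
  simp only [evenDerivationAux]
  rw [ExteriorAlgebra.lift_ι_apply]
  rfl

@[simp]
theorem evenDerivation_algebraMap (A : Module.End R M) (r : R) :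
    evenDerivation A (algebraMap R (ExteriorAlgebra R M) r) = 0 := by
  change evenDerivationAux A (algebraMap R (ExteriorAlgebra R M) r) 0 1 = 0
  simp [Matrix.algebraMap_matrix_apply]

theorem evenDerivationAux_one_one (A : Module.End R M) (a : ExteriorAlgebra R M) :
    evenDerivationAux A a 1 1 = a := by
  have key : evenDerivationAux A a 1 0 = 0 ∧ evenDerivationAux A a 1 1 = a := by
    induction a using ExteriorAlgebra.induction with
    | algebraMap r => simp [Matrix.algebraMap_matrix_apply]
    | ι m =>
      rw [evenDerivationAux_ι]
      exact ⟨rfl, rfl⟩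
    | mul a b ha hb => simp [Matrix.mul_apply, ha, hb]
    | add a b ha hb => simp [ha, hb]
  exact key.2

theorem evenDerivation_ι_mul (A : Module.End R M) (m : M) (a : ExteriorAlgebra R M) :
    evenDerivation A (ι R m * a) = ι R (A m) * a + ι R m * evenDerivation A a := by
  change evenDerivationAux A (ι R m * a) 0 1 = _
  rw [map_mul, evenDerivationAux_ι]
  simp only [Matrix.mul_apply, Fin.sum_univ_two, evenDerivationAux_one_one]
  exact add_comm _ _

/-- A commutator of derivations is a derivation, determined by its values on generators. Relations
of an `sl₂`-triple on `M` thus pass to the exterior algebra. -/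
theorem evenDerivation_lie (A B : Module.End R M) :
    evenDerivation ⁅A, B⁆ = ⁅evenDerivation A, evenDerivation B⁆ := by
  refine LinearMap.ext fun a => ?_
  rw [Ring.lie_def (evenDerivation A), LinearMap.sub_apply, Module.End.mul_apply,
    Module.End.mul_apply]
  induction a using CliffordAlgebra.left_induction with
  | algebraMap r =>
    have h := fun C : Module.End R M => evenDerivation_algebraMap C r
    rw [h, h, h, map_zero, map_zero, sub_zero]
  | add x y hx hy => simp only [map_add, hx, hy]; abel
  | ι_mul x m hx =>
    have h := fun C : Module.End R M => evenDerivation_ι_mul C m x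
    rw [h, h, h, map_add, map_add]
    rw [hx]
    simp only [evenDerivation_ι_mul, Ring.lie_def, LinearMap.sub_apply, Module.End.mul_apply,
      map_sub, sub_mul, mul_sub]
    abel

theorem evenDerivation_add (A B : Module.End R M) :
    evenDerivation (A + B) = evenDerivation A + evenDerivation B := by
  refine LinearMap.ext fun a => ?_
  induction a using CliffordAlgebra.left_induction with
  | algebraMap r =>
    have h := fun C : Module.End R M => evenDerivation_algebraMap C r
    rw [LinearMap.add_apply, h, h, h, add_zero]
  | add x y hx hy => rw [map_add, map_add, hx, hy]
  | ι_mul x m hx =>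
    have h := fun C : Module.End R M => evenDerivation_ι_mul C m x
    rw [LinearMap.add_apply, h, h, h, hx, LinearMap.add_apply, LinearMap.add_apply, map_add,
      add_mul, mul_add]
    abel

theorem evenDerivation_mem (A : Module.End R M) {k : ℕ} {a : ExteriorAlgebra R M}
    (ha : a ∈ ⋀[R]^k M) : evenDerivation A a ∈ ⋀[R]^k M := by
  induction k generalizing a with
  | zero =>
    rw [exteriorPower, pow_zero, Submodule.mem_one] at ha
    obtain ⟨r, rfl⟩ := ha
    simp
  | succ k ih =>
    rw [exteriorPower, pow_succ'] at ha
    induction ha using Submodule.mul_induction_on' with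
    | mem_mul_mem x hx y hy =>
      obtain ⟨m, rfl⟩ := hx
      rw [evenDerivation_ι_mul, exteriorPower, pow_succ']
      exact Submodule.add_mem _
        (Submodule.mul_mem_mul (LinearMap.mem_range_self (ι R) _) hy)
        (Submodule.mul_mem_mul (LinearMap.mem_range_self (ι R) m) (ih hy))
    | add x _ y _ hx hy =>
      rw [map_add]
      exact Submodule.add_mem _ hx hy

theorem evenDerivation_ιMulti (A : Module.End R M) {k : ℕ} (v : Fin k → M) (c : Fin k → R)
    (h : ∀ i, A (v i) = c i • v i) :
    evenDerivation A (ιMulti R k v) = (∑ i, c i) • ιMulti R k v := by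
  induction k with
  | zero =>
    rw [ιMulti_zero_apply, ← map_one (algebraMap R _), evenDerivation_algebraMap]
    simp
  | succ k ih =>
    rw [ιMulti_succ_apply, evenDerivation_ι_mul, h 0, ih (Matrix.vecTail v) (fun i => c i.succ)
      (fun i => h i.succ), Fin.sum_univ_succ, add_smul, map_smul, smul_mul_assoc, mul_smul_comm]

/-- The derivation extending a rank one endomorphism is a creation operator composed with an
annihilation operator. -/
theorem evenDerivation_smulRight (φ : Module.Dual R M) (m : M) (a : ExteriorAlgebra R M) :
    evenDerivation (φ.smulRight m) a =
      ι R m * CliffordAlgebra.contractLeft (Q := (0 : QuadraticForm R M)) φ a := by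
  induction a using CliffordAlgebra.left_induction with
  | algebraMap r =>
    have h := evenDerivation_algebraMap (φ.smulRight m) r
    rw [CliffordAlgebra.contractLeft_algebraMap, mul_zero]
    exact h
  | add x y hx hy => rw [map_add, map_add, hx, hy, mul_add]
  | ι_mul x m' hx =>
    have h := evenDerivation_ι_mul (φ.smulRight m) m' x
    have e := eq_neg_of_add_eq_zero_left (ι_add_mul_swap (R := R) m m')
    rw [CliffordAlgebra.contractLeft_ι_mul]
    refine h.trans ?_
    change _ = ι R m * (φ m' • x - ι R m' * _)
    rw [hx, mul_sub, ← mul_assoc, ← mul_assoc, e, neg_mul, sub_neg_eq_add,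
      LinearMap.smulRight_apply, map_smul, smul_mul_assoc, mul_smul_comm]

variable (R M) in
/-- The action of endomorphisms of `M` by derivations on an exterior power of `M`. -/
noncomputable def evenDerivationPow (k : ℕ) : Module.End R M →+ Module.End R (⋀[R]^k M) :=
  AddMonoidHom.mk' (fun A => (evenDerivation A).restrict fun _ => evenDerivation_mem A) fun A B =>
    LinearMap.ext fun a => Subtype.ext (LinearMap.congr_fun (evenDerivation_add A B) a.1)

@[simp]
theorem coe_evenDerivationPow (k : ℕ) (A : Module.End R M) (a : ⋀[R]^k M) :
    (evenDerivationPow R M k A a : ExteriorAlgebra R M) = evenDerivation A a := rfl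

theorem evenDerivationPow_lie (k : ℕ) (A B : Module.End R M) :
    evenDerivationPow R M k ⁅A, B⁆ = ⁅evenDerivationPow R M k A, evenDerivationPow R M k B⁆ :=
  LinearMap.ext fun a => Subtype.ext (LinearMap.congr_fun (evenDerivation_lie A B) a.1)

theorem evenDerivationPow_basis {I : Type*} [LinearOrder I] (b : Module.Basis I R M)
    (A : Module.End R M) (c : I → R) (h : ∀ i, A (b i) = c i • b i) (k : ℕ)
    (s : Set.powersetCard I k) :
    evenDerivationPow R M k A (b.exteriorPower k s) =
      (∑ i ∈ (s : Finset I), c i) • b.exteriorPower k s := by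
  apply Subtype.ext
  rw [coe_evenDerivationPow, exteriorPower.basis_apply]
  change evenDerivation A (ιMulti R k (b ∘ Set.powersetCard.ofFinEmbEquiv.symm s)) =
    _ • ιMulti R k (b ∘ Set.powersetCard.ofFinEmbEquiv.symm s)
  rw [evenDerivation_ιMulti A (b ∘ Set.powersetCard.ofFinEmbEquiv.symm s)
    (fun i => c (Set.powersetCard.ofFinEmbEquiv.symm s i)) fun i => h _]
  congr 1
  rw [← Finset.sum_coe_sort (s : Finset I)]
  exact ((Set.powersetCard.orderIsoOfFin s).toEquiv.sum_comp (fun i => c i))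

end ExteriorAlgebra

/-! ### The differential of a star -/

section StarDifferential

open ExteriorAlgebra Module

/-- An odd derivation which is given on generators by left multiplication with a fixed vector after
an endomorphism is left multiplication with this vector after an even derivation. -/
theorem ExteriorAlgebra.oddDerivation_eq_ι_mul_evenDerivation {R M : Type*} [CommRing R]
    [AddCommGroup M] [Module R M] (δ : M →ₗ[R] ExteriorAlgebra R M) (hδ : ∀ m, δ m ∈ ⋀[R]^2 M)
    (m₀ : M) (A : Module.End R M) (h : ∀ m, δ m = ι R m₀ * ι R (A m)) (a : ExteriorAlgebra R M) :
    oddDerivation δ hδ a = ι R m₀ * evenDerivation A a := by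
  induction a using CliffordAlgebra.left_induction with
  | algebraMap r =>
    have h1 := oddDerivation_algebraMap δ hδ r
    have h2 := evenDerivation_algebraMap A r
    rw [h1, h2, mul_zero]
  | add x y hx hy => rw [map_add, map_add, hx, hy, mul_add]
  | ι_mul x m hx =>
    have h1 := oddDerivation_ι_mul δ hδ m x
    have h2 := evenDerivation_ι_mul A m x
    have e := eq_neg_of_add_eq_zero_left (ι_add_mul_swap (R := R) m m₀)
    rw [h1, h2, hx, h, mul_add, ← mul_assoc, ← mul_assoc, ← mul_assoc, e, neg_mul, sub_neg_eq_add]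

/-- Serves to cut an `sl₂`-triple down by an idempotent that commutes with it. -/
theorem Module.End.lie_mul_idempotent {R M : Type*} [CommRing R] [AddCommGroup M] [Module R M]
    {p x y : Module.End R M} (hp : p * p = p) (hx : p * x = x * p)
    (hy : p * y = y * p) : ⁅x * p, y * p⁆ = ⁅x, y⁆ * p := by
  have h1 : x * p * (y * p) = x * y * p := by
    rw [mul_assoc, ← mul_assoc p, hy, mul_assoc y, hp, mul_assoc]
  have h2 : y * p * (x * p) = y * x * p := by
    rw [mul_assoc, ← mul_assoc p, hx, mul_assoc x, hp, mul_assoc]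
  rw [Ring.lie_def, Ring.lie_def, h1, h2, sub_mul]

theorem Module.End.one_sub_mul_comm {R M : Type*} [CommRing R] [AddCommGroup M] [Module R M]
    {p x : Module.End R M} (h : p * x = x * p) : (1 - p) * x = x * (1 - p) := by
  rw [sub_mul, mul_sub, one_mul, mul_one, h]

/-! ### The `sl₂`-triple on the generators and its action on exterior powers -/

namespace StarGenerators

variable {Y I : Type*} [AddCommGroup Y] [Module ℝ Y] (b : Basis (Option (I ⊕ I)) ℝ Y)

/-- The endomorphism which sends the second copy of `I` to the first one. -/
noncomputable def raising : Module.End ℝ Y :=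
  b.constr ℝ fun i => i.elim 0 (Sum.elim (fun _ => 0) fun j => b (some (.inl j)))

/-- The endomorphism which sends the first copy of `I` to the second one. -/
noncomputable def lowering : Module.End ℝ Y :=
  b.constr ℝ fun i => i.elim 0 (Sum.elim (fun j => b (some (.inr j))) fun _ => 0)

/-- The weight of a generator. -/
def weight : Option (I ⊕ I) → ℤ :=
  fun i => i.elim 0 (Sum.elim (fun _ => 1) fun _ => -1)

/-- The endomorphism which multiplies each generator by its weight. -/
noncomputable def weightEnd : Module.End ℝ Y :=
  b.constr ℝ fun i => (weight i : ℝ) • b i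

/-- The projection to the distinguished generator. -/
noncomputable def centerProj : Module.End ℝ Y :=
  (b.coord none).smulRight (b none)

theorem lie_raising_lowering : ⁅raising b, lowering b⁆ = weightEnd b := by
  refine b.ext fun i => ?_
  rcases i with _ | i | i <;>
    simp [Ring.lie_def, raising, lowering, weightEnd, Basis.constr_basis, weight]

theorem lie_weightEnd_raising : ⁅weightEnd b, raising b⁆ = 2 • raising b := by
  refine b.ext fun i => ?_
  rcases i with _ | i | i <;>
    simp [Ring.lie_def, raising, weightEnd, Basis.constr_basis, weight, two_smul]

theorem lie_weightEnd_lowering : ⁅weightEnd b, lowering b⁆ = -(2 • lowering b) := by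
  refine b.ext fun i => ?_
  rcases i with _ | i | i <;>
    simp [Ring.lie_def, lowering, weightEnd, Basis.constr_basis, weight, two_smul, sub_eq_add_neg]

theorem lie_centerProj_raising : ⁅centerProj b, raising b⁆ = 0 := by
  refine b.ext fun i => ?_
  rcases i with _ | i | i <;>
    simp [Ring.lie_def, raising, centerProj, Basis.constr_basis]

theorem lie_centerProj_lowering : ⁅centerProj b, lowering b⁆ = 0 := by
  refine b.ext fun i => ?_
  rcases i with _ | i | i <;>
    simp [Ring.lie_def, lowering, centerProj, Basis.constr_basis]

theorem weightEnd_basis (i : Option (I ⊕ I)) : weightEnd b (b i) = (weight i : ℝ) • b i := by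
  rw [weightEnd, Basis.constr_basis]

theorem lie_centerProj_weightEnd : ⁅centerProj b, weightEnd b⁆ = 0 := by
  refine b.ext fun i => ?_
  rcases i with _ | i | i <;>
    simp [Ring.lie_def, weightEnd_basis, centerProj, weight]

/-- The complement of the projection to the multiples of the distinguished generator. -/
noncomputable def coreProj (k : ℕ) : Module.End ℝ (⋀[ℝ]^k Y) :=
  1 - evenDerivationPow ℝ Y k (centerProj b)

theorem ι_mul_evenDerivation_centerProj (u : ExteriorAlgebra ℝ Y) :
    ι ℝ (b none) * evenDerivation (centerProj b) u = 0 := by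
  rw [centerProj, evenDerivation_smulRight, ← mul_assoc, ι_sq_zero, zero_mul]

/-- Write `c` for `b none`. Contracting `c ∧ u = 0` with the coordinate of `c` gives `u = c ∧
(contraction of u)`, and the right side is the derivation extending `centerProj`, applied to `u`. -/
theorem ι_mul_eq_zero_iff (k : ℕ) (u : ⋀[ℝ]^k Y) :
    ι ℝ (b none) * (u : ExteriorAlgebra ℝ Y) = 0 ↔ coreProj b k u = 0 := by
  have hN : ∀ v, evenDerivation (centerProj b) v = _ := evenDerivation_smulRight _ _
  have e : coreProj b k u = 0 ↔
      (u : ExteriorAlgebra ℝ Y) = evenDerivation (centerProj b) (u : ExteriorAlgebra ℝ Y) := by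
    rw [coreProj, LinearMap.sub_apply, sub_eq_zero, Module.End.one_apply, Subtype.ext_iff,
      coe_evenDerivationPow]
  rw [e]
  constructor
  · intro h
    have h1 := CliffordAlgebra.contractLeft_ι_mul (Q := (0 : QuadraticForm ℝ Y)) (b.coord none)
      (b none) (u : ExteriorAlgebra ℝ Y)
    have h2 : CliffordAlgebra.ι (0 : QuadraticForm ℝ Y) (b none) *
      (u : ExteriorAlgebra ℝ Y) = 0 := h
    rw [h2, map_zero, Basis.coord_apply, Basis.repr_self, Finsupp.single_eq_same, one_smul,
      eq_comm, sub_eq_zero] at h1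
    rw [hN]
    exact h1
  · intro h
    rw [h, ι_mul_evenDerivation_centerProj]

/-- The derivation extending `centerProj` multiplies a monomial by the number of its factors equal
to the distinguished generator, which is `0` or `1`. -/
theorem coreProj_basis [LinearOrder (Option (I ⊕ I))] (k : ℕ)
    (s : Set.powersetCard (Option (I ⊕ I)) k) :
    coreProj b k (b.exteriorPower k s) =
      if none ∈ (s : Finset (Option (I ⊕ I))) then 0 else b.exteriorPower k s := by
  have h := evenDerivationPow_basis b (centerProj b) (fun i => if i = none then 1 else 0)
    (fun i => by
      rcases i with _ | i <;> simp [centerProj]) k s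
  have e : (∑ i ∈ (s : Finset (Option (I ⊕ I))), if i = none then (1 : ℝ) else 0) =
      if none ∈ (s : Finset (Option (I ⊕ I))) then 1 else 0 := by
    classical
    convert Finset.sum_ite_eq' (s : Finset (Option (I ⊕ I))) none (fun _ => (1 : ℝ))
  rw [coreProj, LinearMap.sub_apply, h, Module.End.one_apply, e]
  split_ifs <;> simp

theorem coreProj_sq (k : ℕ) : coreProj b k * coreProj b k = coreProj b k := by
  classical
  let : LinearOrder (Option (I ⊕ I)) := linearOrderOfSTO WellOrderingRel
  refine (b.exteriorPower k).ext fun s => ?_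
  rw [Module.End.mul_apply, coreProj_basis]
  split_ifs with h
  · rw [map_zero]
  · rw [coreProj_basis, if_neg h]

theorem coreProj_comm (k : ℕ) {A : Module.End ℝ Y} (h : ⁅centerProj b, A⁆ = 0) :
    coreProj b k * evenDerivationPow ℝ Y k A = evenDerivationPow ℝ Y k A * coreProj b k := by
  have e := evenDerivationPow_lie k (centerProj b) A
  rw [h, map_zero, eq_comm, Ring.lie_def, sub_eq_zero] at e
  exact Module.End.one_sub_mul_comm e

/-- The weight of a monomial: the sum of the weights of its factors, or zero if it is divisible by
the distinguished generator. -/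
noncomputable def monomialWeight (s : Finset (Option (I ⊕ I))) : ℤ := by
  classical exact if none ∈ s then 0 else ∑ i ∈ s, weight i

/-- The projection commutes with the whole triple, so the products form a triple on all of `⋀^k Y`,
to which `finrank_ker_raising` applies with the monomial basis. -/
theorem finrank_ker_raising_mul_coreProj [Finite I] (k : ℕ) :
    finrank ℝ (LinearMap.ker (evenDerivationPow ℝ Y k (raising b) * coreProj b k)) =
      Nat.card {s : Set.powersetCard (Option (I ⊕ I)) k //
        monomialWeight (s : Finset (Option (I ⊕ I))) = 0 ∨
        monomialWeight (s : Finset (Option (I ⊕ I))) = 1} := by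
  classical
  have : Module.Finite ℝ Y := Module.Finite.of_basis b
  let : LinearOrder (Option (I ⊕ I)) := linearOrderOfSTO WellOrderingRel
  have : Fintype (Set.powersetCard (Option (I ⊕ I)) k) := Fintype.ofFinite _
  have hp := coreProj_sq b k
  have he := coreProj_comm b k (lie_centerProj_raising b)
  have hf := coreProj_comm b k (lie_centerProj_lowering b)
  have hh := coreProj_comm b k (lie_centerProj_weightEnd b)
  refine finrank_ker_raising (b.exteriorPower k)
    (w := fun s => monomialWeight (s : Finset (Option (I ⊕ I))))
    (H := evenDerivationPow ℝ Y k (weightEnd b) * coreProj b k)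
    (F := evenDerivationPow ℝ Y k (lowering b) * coreProj b k) ?_ ?_ ?_ ?_
  · intro s
    rw [Module.End.mul_apply, coreProj_basis, monomialWeight]
    by_cases h : none ∈ (s : Finset (Option (I ⊕ I)))
    · rw [if_pos h, if_pos h, map_zero, Int.cast_zero, zero_smul]
    · rw [if_neg h, if_neg h, evenDerivationPow_basis b _ _ (weightEnd_basis b)]
      push_cast
      rfl
  · refine (Module.End.lie_mul_idempotent hp he hf).trans ?_
    rw [← evenDerivationPow_lie, lie_raising_lowering]
  · refine (Module.End.lie_mul_idempotent hp hh he).trans ?_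
    rw [← evenDerivationPow_lie, lie_weightEnd_raising, map_nsmul]
    rfl
  · refine (Module.End.lie_mul_idempotent hp hh hf).trans ?_
    rw [← evenDerivationPow_lie, lie_weightEnd_lowering, map_neg, map_nsmul]
    rfl

/-- The dimension of the kernel of the differential of a star on an exterior power. -/
theorem finrank_ker_differential [Finite I] (D : Module.End ℝ (ExteriorAlgebra ℝ Y))
    (hD : ∀ a, D a = ι ℝ (b none) * evenDerivation (raising b) a) (k : ℕ) :
    finrank ℝ (LinearMap.ker (D.domRestrict (⋀[ℝ]^k Y))) =
      Nat.card {s : Set.powersetCard (Option (I ⊕ I)) k //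
        monomialWeight (s : Finset (Option (I ⊕ I))) = 0 ∨
        monomialWeight (s : Finset (Option (I ⊕ I))) = 1} := by
  rw [← finrank_ker_raising_mul_coreProj b k]
  suffices h : LinearMap.ker (D.domRestrict (⋀[ℝ]^k Y)) =
      LinearMap.ker (evenDerivationPow ℝ Y k (raising b) * coreProj b k) by rw [h]
  ext u
  rw [← coreProj_comm b k (lie_centerProj_raising b), LinearMap.mem_ker, LinearMap.mem_ker,
    LinearMap.domRestrict_apply, hD, Module.End.mul_apply]
  exact ι_mul_eq_zero_iff b k (evenDerivationPow ℝ Y k (raising b) u)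

end StarGenerators

end StarDifferential

/-! ### Counting monomials of weight zero or one -/

namespace StarGenerators

variable {I : Type*}

/-- The monomials of degree `k + 1` of weight zero or one. -/
theorem card_monomials_succ [Fintype I] (k : ℕ) :
    Nat.card {s : Set.powersetCard (Option (I ⊕ I)) (k + 1) //
        monomialWeight (s : Finset (Option (I ⊕ I))) = 0 ∨
        monomialWeight (s : Finset (Option (I ⊕ I))) = 1} =
      (2 * Fintype.card I).choose k +
        (Fintype.card I).choose ((k + 2) / 2) * (Fintype.card I).choose ((k + 1) / 2) := by
  classical
  let f : Finset I × Finset I → Finset (Option (I ⊕ I)) :=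
    fun P => (P.1.disjSum P.2).map Function.Embedding.some
  have hf : Function.Injective f := by
    rintro ⟨P, Q⟩ ⟨P', Q'⟩ h
    have h' := Finset.map_injective _ h
    rw [Finset.disjSum_inj] at h'
    exact Prod.ext h'.1 h'.2
  -- `S` collects the monomials containing the distinguished generator, all of weight zero. For the
  -- others, `p + q = k + 1` and `p - q ∈ {0, 1}` force the two sizes in `T`.
  let S : Set (Finset (Option (I ⊕ I))) :=
    Finset.insertNone '' (Finset.powersetCard k (Finset.univ : Finset (I ⊕ I)))
  let T : Set (Finset (Option (I ⊕ I))) :=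
    f '' (Finset.powersetCard ((k + 2) / 2) (Finset.univ : Finset I) ×ˢ
      Finset.powersetCard ((k + 1) / 2) (Finset.univ : Finset I) : Finset (Finset I × Finset I))
  have hw : ∀ P, monomialWeight (f P) = (P.1.card : ℤ) - P.2.card := by
    intro P
    rw [monomialWeight, if_neg (by simp [f])]
    simp [f, Finset.sum_disjSum, weight, sub_eq_add_neg]
  have hST : {s : Finset (Option (I ⊕ I)) | s.card = k + 1 ∧
      (monomialWeight s = 0 ∨ monomialWeight s = 1)} = S ∪ T := by
    ext s
    constructor
    · rintro ⟨hc, hs⟩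
      by_cases hn : none ∈ s
      · left
        have e : Finset.insertNone (Finset.eraseNone s) = s := by
          rw [Finset.insertNone_eraseNone, Finset.insert_eq_of_mem hn]
        refine ⟨Finset.eraseNone s, ?_, e⟩
        rw [← e, Finset.card_insertNone] at hc
        simp only [Finset.mem_coe, Finset.mem_powersetCard_univ]
        omega
      · right
        have e : f ((Finset.eraseNone s).toLeft, (Finset.eraseNone s).toRight) = s := by
          simp only [f, Finset.toLeft_disjSum_toRight, Finset.map_some_eraseNone]
          exact Finset.erase_eq_of_notMem hn
        generalize ((Finset.eraseNone s).toLeft, (Finset.eraseNone s).toRight) = P at e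
        subst e
        refine ⟨P, ?_, rfl⟩
        rw [hw] at hs
        simp only [f, Finset.card_map, Finset.card_disjSum] at hc
        simp only [Finset.mem_coe, Finset.mem_product, Finset.mem_powersetCard_univ]
        omega
    · rintro (⟨t, ht, rfl⟩ | ⟨P, hP, rfl⟩)
      · simp only [Finset.mem_coe, Finset.mem_powersetCard_univ] at ht
        refine ⟨by rw [Finset.card_insertNone, ht], Or.inl ?_⟩
        rw [monomialWeight, if_pos (by simp)]
      · simp only [Finset.mem_coe, Finset.mem_product, Finset.mem_powersetCard_univ] at hP
        refine ⟨?_, ?_⟩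
        · simp only [f, Finset.card_map, Finset.card_disjSum]
          omega
        · rw [hw]
          omega
  have hdisj : Disjoint S T := by
    rw [Set.disjoint_left]
    rintro _ ⟨t, -, rfl⟩ ⟨P, -, hP⟩
    have : none ∈ f P := by rw [hP]; simp
    simp [f] at this
  have hcard : Nat.card {s : Set.powersetCard (Option (I ⊕ I)) (k + 1) //
        monomialWeight (s : Finset (Option (I ⊕ I))) = 0 ∨
        monomialWeight (s : Finset (Option (I ⊕ I))) = 1} = (S ∪ T).ncard := by
    rw [← hST, ← Nat.card_coe_set_eq]
    exact Nat.card_congr (Equiv.subtypeSubtypeEquivSubtypeInter _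
      (fun s : Finset (Option (I ⊕ I)) => monomialWeight s = 0 ∨ monomialWeight s = 1))
  rw [hcard, Set.ncard_union_eq hdisj, Set.ncard_image_of_injective _
    Finset.insertNone.injective, Set.ncard_image_of_injective _ hf, Set.ncard_coe_finset,
    Set.ncard_coe_finset]
  simp [two_mul]

/-- The only monomial of degree zero has weight zero. -/
theorem card_monomials_zero :
    Nat.card {s : Set.powersetCard (Option (I ⊕ I)) 0 //
        monomialWeight (s : Finset (Option (I ⊕ I))) = 0 ∨
        monomialWeight (s : Finset (Option (I ⊕ I))) = 1} = 1 := by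
  rw [Nat.card_eq_one_iff_exists]
  have h : ∀ s : Set.powersetCard (Option (I ⊕ I)) 0, (s : Finset (Option (I ⊕ I))) = ∅ :=
    fun s => Finset.card_eq_zero.mp s.2
  refine ⟨⟨⟨∅, rfl⟩, Or.inl (by simp [monomialWeight])⟩, fun s => ?_⟩
  exact Subtype.ext (Subtype.ext (h s.1))

end StarGenerators

/-! ### Betti numbers from the dimensions of the cocycles -/

section

open CartanChevalleyEilenberg Module

variable {L : Type*} [LieRing L] [LieAlgebra ℝ L] [Module.Finite ℝ L]

theorem finrank_cocycles (k : ℕ) : finrank ℝ (cocycles L k) =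
    finrank ℝ (LinearMap.ker ((differential L).domRestrict (⋀[ℝ]^k (Dual ℝ L)))) := by
  have e : LinearMap.ker ((differential L).domRestrict (⋀[ℝ]^k (Dual ℝ L))) =
      (cocycles L k).submoduleOf (⋀[ℝ]^k (Dual ℝ L)) := by
    ext x
    simp [Submodule.submoduleOf, cocycles]
  rw [e]
  exact (Submodule.submoduleOfEquivOfLe inf_le_left).finrank_eq.symm

theorem finrank_cohomology_add (k : ℕ) :
    finrank ℝ (Cohomology L k) + finrank ℝ (coboundaries L k) = finrank ℝ (cocycles L k) := by
  rw [← (Submodule.submoduleOfEquivOfLe (coboundaries_le_cocycles (L := L) k)).finrank_eq]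
  exact Submodule.finrank_quotient_add_finrank _

/-- Rank-nullity on `⋀^k L*`. -/
theorem finrank_coboundaries_succ_add (k : ℕ) :
    finrank ℝ (coboundaries L (k + 1)) + finrank ℝ (cocycles L k) =
      (finrank ℝ L).choose k := by
  rw [finrank_cocycles, ← Subspace.dual_finrank_eq (K := ℝ) (V := L), ← exteriorPower.finrank_eq ℝ k,
    ← LinearMap.finrank_range_add_finrank_ker
      ((differential L).domRestrict (⋀[ℝ]^k (Dual ℝ L))), LinearMap.range_domRestrict]
  rfl

/-- The cohomology of a Lie algebra with a basis `c, x_i, z_i` in which the only nonzero brackets of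
basis vectors are `[c, x_i] = z_i` and `[x_i, c] = -z_i`. -/
theorem finrank_cohomology_of_star_basis {I : Type*} [Fintype I]
    (B : Basis (Option (I ⊕ I)) ℝ L)
    (h0 : ∀ u v : L, B.coord none ⁅u, v⁆ = 0) (h1 : ∀ i, ∀ u v : L, B.coord (some (.inl i)) ⁅u, v⁆ = 0)
    (h2 : ∀ i, ∀ u v : L, B.coord (some (.inr i)) ⁅u, v⁆ =
      B.coord none u * B.coord (some (.inl i)) v - B.coord (some (.inl i)) u * B.coord none v)
    (k : ℕ) : finrank ℝ (Cohomology L k) =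
      (Fintype.card I + 1).choose ((k + 1) / 2) * (Fintype.card I).choose (k / 2) := by
  classical
  let b := B.dualBasis
  have hb : ∀ i, b i = B.coord i := fun i => congrFun B.coe_dualBasis i
  have hD : ∀ a, differential L a =
      ExteriorAlgebra.ι ℝ (b none) *
        ExteriorAlgebra.evenDerivation (StarGenerators.raising b) a := by
    refine ExteriorAlgebra.oddDerivation_eq_ι_mul_evenDerivation _ _ _ _ fun m => ?_
    have e : differentialOne L = LinearMap.mulLeft ℝ (ExteriorAlgebra.ι ℝ (b none)) ∘ₗ
        ExteriorAlgebra.ι ℝ ∘ₗ StarGenerators.raising b := by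
      refine b.ext fun i => ?_
      rw [LinearMap.comp_apply, LinearMap.comp_apply, StarGenerators.raising, Basis.constr_basis,
        LinearMap.mulLeft_apply]
      rcases i with _ | i | i
      · rw [hb, differentialOne_eq_mul (φ := 0) (ψ := 0) (by simpa using h0)]
        simp
      · rw [hb, differentialOne_eq_mul (φ := 0) (ψ := 0) (by simpa using h1 i)]
        simp
      · rw [hb, hb, differentialOne_eq_mul (h2 i)]
        simp [hb]
    exact LinearMap.congr_fun e m
  have hc : ∀ k, finrank ℝ (cocycles L k) = _ := fun k =>
    (finrank_cocycles k).trans (StarGenerators.finrank_ker_differential b _ hD k)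
  have hL : finrank ℝ L = 2 * Fintype.card I + 1 := by
    rw [finrank_eq_card_basis B]
    simp [two_mul]
  have hH := finrank_cohomology_add (L := L) k
  -- Degrees zero and one are separate because the count of cocycles in degree zero has no term from
  -- multiples of the distinguished generator.
  rcases k with _ | k
  · rw [hc, StarGenerators.card_monomials_zero] at hH
    have : finrank ℝ (coboundaries L 0) = 0 := finrank_bot ℝ _
    simpa [this] using hH
  have hB := finrank_coboundaries_succ_add (L := L) k
  rw [hc, StarGenerators.card_monomials_succ] at hH
  rcases k with _ | k
  · rw [hc, StarGenerators.card_monomials_zero] at hB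
    simp at hB hH ⊢
    omega
  -- The degree is now `k + 2`. Pascal's rule splits `C(2n+1, k+1)` into the two binomials of `2n`
  -- that occur in the cocycle counts, so these cancel.
  rw [hc, StarGenerators.card_monomials_succ, hL, Nat.choose_succ_succ'] at hB
  have e : (k + 1 + 2) / 2 = (k + 1) / 2 + 1 := by omega
  have e' : (k + 1 + 1 + 1) / 2 = (k + 1) / 2 + 1 := by omega
  have e'' : (k + 1 + 1) / 2 = (k + 2) / 2 := by omega
  rw [e, e''] at hH
  rw [e', e'', Nat.choose_succ_succ', add_mul]
  have := mul_comm ((Fintype.card I).choose ((k + 2) / 2)) ((Fintype.card I).choose ((k + 1) / 2))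
  omega

end

/-! ### The Dani-Mainkar Lie algebra of a star -/

section

variable {V : Type*} [DecidableEq V]

theorem DaniMainkar.wedgeClass_single_of_not_adj (G : SimpleGraph V) {i j : V}
    (h : ¬ G.Adj i j) : wedgeClass G (Pi.single i 1) (Pi.single j 1) = 0 := by
  rw [wedgeClass_apply, Submodule.mkQ_apply, Submodule.Quotient.mk_eq_zero]
  exact Submodule.subset_span ⟨i, j, h, rfl⟩

theorem DaniMainkar.wedgeClass_swap (G : SimpleGraph V) (x y : V → ℝ) :
    wedgeClass G x y = -wedgeClass G y x := by
  have h := wedgeClass_self G (x + y)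
  simp only [map_add, LinearMap.add_apply, wedgeClass_self, zero_add, add_zero] at h
  exact eq_neg_of_add_eq_zero_right h

end

namespace DaniMainkar

variable (n : ℕ)

/-- The star graph with center `0` and leaves `1, …, n`. -/
abbrev star : SimpleGraph (Fin (n + 1)) := SimpleGraph.starGraph 0

/-- The `2 × 2` minor of the coordinates at the center and at a leaf. -/
noncomputable def starMinor (i : Fin n) : (Fin (n + 1) → ℝ) [⋀^Fin 2]→ₗ[ℝ] ℝ :=
  (Matrix.detRowAlternating (n := Fin 2) (R := ℝ)).compLinearMap
    (LinearMap.pi ![LinearMap.proj 0, LinearMap.proj i.succ])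

theorem starMinor_apply (i : Fin n) (v : Fin 2 → Fin (n + 1) → ℝ) :
    starMinor n i v = v 0 0 * v 1 i.succ - v 0 i.succ * v 1 0 := by
  rw [starMinor, AlternatingMap.compLinearMap_apply]
  exact Matrix.det_fin_two _

/-- The edge coordinates on the exterior square modulo non-edges. -/
noncomputable def starEdgeCoord :
    (⋀[ℝ]^2 (Fin (n + 1) → ℝ) ⧸ (star n).nonEdgeSpan) →ₗ[ℝ] (Fin n → ℝ) :=
  (star n).nonEdgeSpan.liftQ
    (LinearMap.pi fun i => exteriorPower.alternatingMapLinearEquiv (starMinor n i)) (by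
      rw [SimpleGraph.nonEdgeSpan, Submodule.span_le]
      rintro _ ⟨i, j, hij, rfl⟩
      rw [SetLike.mem_coe, LinearMap.mem_ker]
      ext l
      rw [LinearMap.pi_apply, exteriorPower.alternatingMapLinearEquiv_apply_ιMulti,
        starMinor_apply]
      rw [SimpleGraph.starGraph_adj] at hij
      revert hij
      -- The minor vanishes on two leaves and on the center twice; a center and a leaf are adjacent,
      -- which `hij` excludes.
      refine Fin.cases ?_ (fun i => ?_) i <;> refine Fin.cases ?_ (fun j => ?_) j <;>
        simp [Pi.single_apply, Fin.succ_ne_zero, (Fin.succ_ne_zero _).symm])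

theorem starEdgeCoord_wedgeClass (x y : Fin (n + 1) → ℝ) (i : Fin n) :
    starEdgeCoord n (wedgeClass (star n) x y) i = x 0 * y i.succ - x i.succ * y 0 := by
  rw [wedgeClass_apply, Submodule.mkQ_apply, starEdgeCoord, Submodule.liftQ_apply,
    LinearMap.pi_apply, exteriorPower.alternatingMapLinearEquiv_apply_ιMulti, starMinor_apply]
  rfl

/-- The combination of the classes of the edges with given coefficients. -/
noncomputable def starEdgeSum :
    (Fin n → ℝ) →ₗ[ℝ] (⋀[ℝ]^2 (Fin (n + 1) → ℝ) ⧸ (star n).nonEdgeSpan) :=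
  Fintype.linearCombination ℝ fun i : Fin n =>
    wedgeClass (star n) (Pi.single 0 1) (Pi.single i.succ 1)

/-- By bilinearity it suffices to take basis vectors: a non-edge has class zero, and an edge is, up
to sign, one of the classes summed by `starEdgeSum`. -/
theorem wedgeClass_star (x y : Fin (n + 1) → ℝ) :
    starEdgeSum n (starEdgeCoord n (wedgeClass (star n) x y)) = wedgeClass (star n) x y := by
  have h : (wedgeClass (star n)).compr₂ (starEdgeSum n ∘ₗ starEdgeCoord n) = wedgeClass (star n) := by
    have e : ∀ i : Fin n, starEdgeSum n (starEdgeCoord n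
        (wedgeClass (star n) (Pi.single 0 1) (Pi.single i.succ 1))) =
        wedgeClass (star n) (Pi.single 0 1) (Pi.single i.succ 1) := by
      intro i
      have : starEdgeCoord n (wedgeClass (star n) (Pi.single 0 1) (Pi.single i.succ 1)) =
          Pi.single i 1 := by
        ext j
        rw [starEdgeCoord_wedgeClass]
        simp [Pi.single_apply, Fin.succ_ne_zero]
      rw [this, starEdgeSum, Fintype.linearCombination_apply_single, one_smul]
    refine (Pi.basisFun ℝ _).ext fun i => (Pi.basisFun ℝ _).ext fun j => ?_
    rw [Pi.basisFun_apply, Pi.basisFun_apply, LinearMap.compr₂_apply, LinearMap.comp_apply]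
    by_cases hij : (star n).Adj i j
    · rw [SimpleGraph.starGraph_adj] at hij
      rcases hij with ⟨hne, rfl | rfl⟩
      · obtain ⟨j, rfl⟩ := Fin.exists_succ_eq.mpr hne.symm
        exact e j
      · obtain ⟨i, rfl⟩ := Fin.exists_succ_eq.mpr hne
        rw [wedgeClass_swap, map_neg, map_neg, e i]
    · rw [wedgeClass_single_of_not_adj _ hij, map_zero, map_zero]
  exact LinearMap.congr_fun₂ h x y

/-- The exterior square modulo non-edges has a basis indexed by the edges. -/
noncomputable def starEdgeEquiv :
    (⋀[ℝ]^2 (Fin (n + 1) → ℝ) ⧸ (star n).nonEdgeSpan) ≃ₗ[ℝ] (Fin n → ℝ) :=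
  LinearEquiv.ofLinearMap (starEdgeCoord n) (starEdgeSum n)
    (by
      refine (Pi.basisFun ℝ _).ext fun i => ?_
      rw [Pi.basisFun_apply, LinearMap.comp_apply, starEdgeSum,
        Fintype.linearCombination_apply_single, one_smul]
      ext j
      rw [starEdgeCoord_wedgeClass]
      simp [Pi.single_apply, Fin.succ_ne_zero])
    (by
      -- Linear maps out of the quotient are compared on the classes of decomposable bivectors.
      refine Submodule.linearMap_qext _ (exteriorPower.linearMap_ext
        (AlternatingMap.ext fun v => ?_))
      have e : v = ![v 0, v 1] := by ext i; fin_cases i <;> rfl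
      rw [e]
      exact wedgeClass_star n (v 0) (v 1))

/-- The coordinates on the Dani-Mainkar Lie algebra of a star given by the vertices and the
edges. -/
noncomputable def starEquivFun : DaniMainkar (star n) ≃ₗ[ℝ] (Option (Fin n ⊕ Fin n) → ℝ) where
  toFun u o := o.elim (u.1 0) (Sum.elim (fun i => u.1 i.succ) (starEdgeEquiv n u.2))
  invFun f := (Fin.cons (f none) fun i => f (some (.inl i)),
    (starEdgeEquiv n).symm fun i => f (some (.inr i)))
  map_add' u v := by
    ext o
    rcases o with _ | i | i
    · rfl
    · rfl
    · exact congrFun (map_add (starEdgeEquiv n) u.2 v.2) i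
  map_smul' c u := by
    ext o
    rcases o with _ | i | i
    · rfl
    · rfl
    · exact congrFun (map_smul (starEdgeEquiv n) c u.2) i
  left_inv u := by
    refine Prod.ext ?_ ?_
    · ext i
      refine Fin.cases ?_ (fun i => ?_) i <;> rfl
    · exact (starEdgeEquiv n).symm_apply_apply u.2
  right_inv f := by
    ext o
    rcases o with _ | i | i
    · rfl
    · rfl
    · exact congrFun ((starEdgeEquiv n).apply_symm_apply _) i

/-- The basis of the Dani-Mainkar Lie algebra of a star given by the vertices and the edges. -/
noncomputable def starBasis : Module.Basis (Option (Fin n ⊕ Fin n)) ℝ (DaniMainkar (star n)) :=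
  .ofEquivFun (starEquivFun n)

theorem starBasis_coord_inr (i : Fin n) (u : DaniMainkar (star n)) :
    (starBasis n).coord (some (.inr i)) u = starEdgeCoord n u.2 i := rfl

end DaniMainkar

theorem mainTheorem4 (n k : ℕ) :
    (SimpleGraph.starGraph (0 : Fin (n + 1))).bettiNumber k =
      (n + 1).choose ⌈(k : ℚ) / 2⌉₊ * n.choose ⌊(k : ℚ) / 2⌋₊ := by
  have hfloor : ⌊(k : ℚ) / 2⌋₊ = k / 2 := by
    have := Nat.floor_div_eq_div (K := ℚ) k 2
    exact_mod_cast this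
  have hceil : ⌈(k : ℚ) / 2⌉₊ = (k + 1) / 2 := by
    rcases Nat.even_or_odd' k with ⟨m, rfl | rfl⟩
    · have h1 : ((2 * m : ℕ) : ℚ) / 2 = (m : ℕ) := by push_cast; ring
      rw [h1, Nat.ceil_natCast]
      omega
    · rw [Nat.ceil_eq_iff (by omega)]
      have h2 : (2 * m + 1 + 1) / 2 = m + 1 := by omega
      rw [h2, Nat.add_sub_cancel]
      push_cast
      constructor <;> linarith
  -- The vertex coordinates of a bracket vanish by definition; only the edge coordinates remain to
  -- be computed.
  rw [hfloor, hceil, SimpleGraph.bettiNumber,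
    finrank_cohomology_of_star_basis (DaniMainkar.starBasis n) (fun _ _ => rfl)
      (fun _ _ _ => rfl) ?_ k, Fintype.card_fin]
  intro i u v
  rw [DaniMainkar.starBasis_coord_inr, DaniMainkar.bracket_def]
  exact DaniMainkar.starEdgeCoord_wedgeClass n u.1 v.1 i
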